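/- Let $n\ge 3$. For $0<\varepsilon<\left(\frac{n-2}{n}\right)^{(n-2)/4}$ let $v_\varepsilon$ denote a Fowler profile of necksize $\varepsilon$, that is, a positive periodic $C^2$ function $v_\varepsilon:\mathbb R\to\mathbb R$ with $\min v_\varepsilon=\varepsilon$ and $$v_\varepsilon''-\tfrac{(n-2)^2}{4}v_\varepsilon+\tfrac{n(n-2)}{4}v_\varepsilon^{\frac{n+2}{n-2}}=0$$ (equivalently, $|x|^{\frac{2-n}{2}}v_\varepsilon(-\log|x|)$ solves $\Delta u+\frac{n(n-2)}4u^{\frac{n+2}{n-2}}=0$ on $\mathbb R^n\setminus\{0\}$). Let $\lambda_0=0$ and $\lambda_1=\dots=\lambda_n=n-1$ be the first $n+1$ eigenvalues of $-\Delta_{\mathbb S^{n-1}}$, counted with multiplicity. For a unit vector $\Lambda\in\mathbb R^d$ and $j\in\{0,\dots,n\}$ consider, for $\mathcal W=(w_1,\dots,w_d)$, the operator $$\mathcal L^i_{\varepsilon,j}(\mathcal W)=\ddot w_i-\tfrac{(n-2)^2}{4}w_i-\lambda_jw_i+n v_\varepsilon^{\frac4{n-2}}\langle\mathcal W,\Lambda\rangle\Lambda_i+\tfrac{n(n-2)}4v_\varepsilon^{\frac4{n-2}}w_i,\qquad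 i=1,\dots,d,$$ and the backward Cauchy problem $$\mathcal L^i_{\varepsilon,j}(\mathcal W)=f_i\ \text{ in }(-\infty,T),\quad i=1,\dots,d,\qquad \mathcal W(T)=\dot{\mathcal W}(T)=0.\tag{$*$}$$ For an open interval $I$ put $\|f\|_{C^0_{\delta;d}(I)}=\sup_{t\in I}e^{\delta t}|f(t)|$ with the Euclidean norm $|\cdot|$; $C^k_{\delta;d}(I)$ is the space of $C^k$ maps $I\to\mathbb R^d$ all of whose derivatives of order at most $k$ have finite $C^0_{\delta;d}(I)$ norm. (a) For every $\delta>\frac{n-2}2$ there exist constants $\varepsilon_0\in\left(0,\left(\frac{n-2}{n}\right)^{(n-2)/4}\right)$ and $C>0$, depending only on $n$ and $\delta$, such that for all $d$, all unit vectors $\Lambda\in\mathbb R^d$, all $\varepsilon\in(0,\varepsilon_0]$ and all $v_\varepsilon$ as above, all $R>0$ and $T>\log R$, all $f\in C^0_{\delta;d}(-\infty,T)$ and every solution $\mathcal W\in C^2_{\delta;d}(\log R,T)$ of $(*)$ with $j=0$, $$\|\mathcal W\|_{C^0_{\delta;d}(\log R,T)}\le C\,\|f\|_{C^0_{\delta;d}(\log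 R,T)}.$$ (b) For every $\delta>\frac n2$ there exist constants $\varepsilon_0$ and $C$ as in (a), depending only on $n$ and $\delta$, such that the same estimate holds for the solutions of $(*)$ with any $j\in\{1,\dots,n\}$. -/

import Mathlib

open Set

noncomputable section

/-- `v` is a Fowler (Delaunay) profile in dimension `n` with necksize `ε`: a positive periodic
function with minimum `ε` such that `u(x) = |x|^((2-n)/2) v(-log |x|)` solves
`Δu + n(n-2)/4 u^((n+2)/(n-2)) = 0` on `ℝⁿ ∖ {0}`; in the variable `t = -log |x|` this is the
equation below. -/
structure IsFowlerProfile (n : ℕ) (ε : ℝ) (v : ℝ → ℝ) : Prop where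
  contDiff : ContDiff ℝ 2 v
  pos : ∀ t, 0 < v t
  periodic : ∃ p > 0, Function.Periodic v p
  isLeast : IsLeast (range v) ε
  equation : ∀ t, iteratedDeriv 2 v t - ((n : ℝ) - 2) ^ 2 / 4 * v t
    + (n : ℝ) * ((n : ℝ) - 2) / 4 * v t ^ (((n : ℝ) + 2) / ((n : ℝ) - 2)) = 0

/-- The eigenvalues `λ_0, …, λ_n` of `-Δ` on the unit sphere `S^(n-1)`, counted with multiplicity:
`0` (constant functions) and `n - 1` (the `n` coordinate functions). -/
def lowEigenvalue (n : ℕ) (j : Fin (n + 1)) : ℝ := if j = 0 then 0 else (n : ℝ) - 1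

/-- The `i`-th component at time `t` of the linearized operator restricted to the mode `j`, applied
to `W = (w_1, …, w_d)`. -/
def modeOperator (n : ℕ) {d : ℕ} (j : Fin (n + 1)) (Λ : EuclideanSpace ℝ (Fin d)) (v : ℝ → ℝ)
    (W : ℝ → EuclideanSpace ℝ (Fin d)) (t : ℝ) (i : Fin d) : ℝ :=
  iteratedDeriv 2 (fun s => W s i) t - ((n : ℝ) - 2) ^ 2 / 4 * W t i - lowEigenvalue n j * W t i
    + (n : ℝ) * v t ^ (4 / ((n : ℝ) - 2)) * inner ℝ (W t) Λ * Λ i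
    + (n : ℝ) * ((n : ℝ) - 2) / 4 * v t ^ (4 / ((n : ℝ) - 2)) * W t i

/-- `W` solves the backward Cauchy problem for the mode `j` on `(-∞, T)` with right-hand side `f`
and zero Cauchy data at `T`. -/
structure IsBackwardSolution (n : ℕ) {d : ℕ} (j : Fin (n + 1)) (Λ : EuclideanSpace ℝ (Fin d))
    (v : ℝ → ℝ) (T : ℝ) (f W : ℝ → EuclideanSpace ℝ (Fin d)) : Prop where
  contDiffOn : ContDiffOn ℝ 2 W (Iio T)
  equation : ∀ t < T, ∀ i, modeOperator n j Λ v W t i = f t i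
  terminal_value : W T = 0
  terminal_deriv : HasDerivWithinAt W 0 (Iic T) T

/-- The weighted norm `sup_{t ∈ I} e^{δt} |f(t)|`, with values in `[0, ∞]`. -/
def weightedSup {d : ℕ} (δ : ℝ) (I : Set ℝ) (f : ℝ → EuclideanSpace ℝ (Fin d)) : ENNReal :=
  ⨆ t ∈ I, ENNReal.ofReal (Real.exp (δ * t) * ‖f t‖)

/-- Membership in the weighted space `C^k_{δ;d}(I)`, for an open interval `I`. -/
def MemWeighted {d : ℕ} (k : ℕ) (δ : ℝ) (I : Set ℝ) (f : ℝ → EuclideanSpace ℝ (Fin d)) : Prop :=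
  ContDiffOn ℝ k f I ∧ ∀ m ≤ k, weightedSup δ I (iteratedDerivWithin m f I) < ⊤

end

/-! In mode `j` the system reads `W'' = μ² W + g`, with `μ = (n-2)/2` for `j = 0` and `μ = n/2`
otherwise. Here `g` consists of `f` and a coupling of size at most `κ q ‖W‖`, where `q = v ^
(4/(n-2))`. Without the coupling, solutions grow backward in time at rate at most `μ`, and `δ > μ`
leaves room for an exponential barrier of rate `δ`.

The coupling is not uniformly small, but it is small on average: `exists_corrector` gives `q ≤
(n-2)/(-log ε) + P'` with `|P| ≤ 1`. For small `ε` the first term costs only part of the gap `δ -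
μ`. The second is absorbed by the factor `exp(-(κ/μ) P)` in the barrier, which changes the constants
by a bounded factor. `norm_le_of_backward_equation` compares the energy with this barrier, and no
constant depends on the interval, `ε` or `d`. -/

/-! ### Fowler profiles: first integral and averaged smallness of the potential. -/

/-- A Fowler profile of necksize `ε < 1` satisfies a first integral. -/
theorem IsFowlerProfile.first_integral {n : ℕ} (hn : 3 ≤ n) {ε : ℝ} {v : ℝ → ℝ}
    (hv : IsFowlerProfile n ε v) (t : ℝ) :
    deriv v t ^ 2 = (((n : ℝ) - 2) / 2) ^ 2 * (v t ^ 2 * (1 - v t ^ (4 / ((n : ℝ) - 2))))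
      - (((n : ℝ) - 2) / 2) ^ 2 * (ε ^ 2 * (1 - ε ^ (4 / ((n : ℝ) - 2)))) := by
  have hn' : (3 : ℝ) ≤ n := by exact_mod_cast hn
  have hn2 : (n : ℝ) - 2 ≠ 0 := by linarith
  have hd1 : ∀ s, HasDerivAt v (deriv v s) s := fun s =>
    (hv.contDiff.differentiable (by norm_num) s).hasDerivAt
  have hd2 : ∀ s, HasDerivAt (deriv v) (iteratedDeriv 2 v s) s := fun s => by
    have h : Differentiable ℝ (deriv v) := by
      have := hv.contDiff.differentiable_iteratedDeriv 1 (by norm_num)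
      rwa [iteratedDeriv_one] at this
    have h2 := (h s).hasDerivAt
    rwa [show iteratedDeriv 2 v s = deriv (deriv v) s by
      rw [iteratedDeriv_succ, iteratedDeriv_one]]
  have hq : ∀ s, HasDerivAt (fun s => v s ^ (4 / ((n : ℝ) - 2)))
      (deriv v s * (4 / ((n : ℝ) - 2)) * v s ^ (4 / ((n : ℝ) - 2) - 1)) s := fun s =>
    (hd1 s).rpow_const (Or.inl (hv.pos s).ne')
  let H : ℝ → ℝ := fun s => deriv v s ^ 2
    - (((n : ℝ) - 2) / 2) ^ 2 * (v s ^ 2 * (1 - v s ^ (4 / ((n : ℝ) - 2))))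
  have hH : ∀ s, HasDerivAt H 0 s := fun s => by
    have h := ((hd2 s).pow 2).sub
      ((((hd1 s).pow 2).mul ((hq s).const_sub 1)).const_mul ((((n : ℝ) - 2) / 2) ^ 2))
    refine h.congr_deriv ?_
    have he := hv.equation s
    have hpos := hv.pos s
    have e1 : v s ^ (((n : ℝ) + 2) / ((n : ℝ) - 2)) = v s * v s ^ (4 / ((n : ℝ) - 2)) := by
      rw [show ((n : ℝ) + 2) / ((n : ℝ) - 2) = 1 + 4 / ((n : ℝ) - 2) by field_simp; ring,
        Real.rpow_add hpos, Real.rpow_one]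
    have e2 : v s ^ (4 / ((n : ℝ) - 2) - 1) = v s ^ (4 / ((n : ℝ) - 2)) / v s := by
      rw [Real.rpow_sub hpos, Real.rpow_one]
    rw [e1] at he
    rw [e2, show iteratedDeriv 2 v s = ((n : ℝ) - 2) ^ 2 / 4 * v s
      - (n : ℝ) * ((n : ℝ) - 2) / 4 * (v s * v s ^ (4 / ((n : ℝ) - 2))) by linarith]
    generalize v s ^ (4 / ((n : ℝ) - 2)) = Q
    have hvne := hpos.ne'
    simp only [Pi.pow_apply]
    field_simp
    ring
  obtain ⟨t₀, ht₀⟩ := hv.isLeast.1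
  have hmin : deriv v t₀ = 0 := by
    refine IsLocalMin.deriv_eq_zero (Filter.Eventually.of_forall fun s => ?_)
    rw [ht₀]
    exact hv.isLeast.2 (mem_range_self s)
  have hc : H t = H t₀ := is_const_of_deriv_eq_zero (fun s => (hH s).differentiableAt)
    (fun s => (hH s).deriv) t t₀
  simp only [H, hmin, ht₀] at hc
  linarith

/-- Along a Fowler profile of small necksize, the potential `v ^ (4 / (n - 2))` is at most a small
constant plus the derivative of a function bounded by `1`. -/
theorem IsFowlerProfile.exists_corrector {n : ℕ} (hn : 3 ≤ n) {ε : ℝ} {v : ℝ → ℝ}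
    (hv : IsFowlerProfile n ε v) (hε : ε < 1) :
    ∃ P P' : ℝ → ℝ, (∀ t, HasDerivAt P (P' t) t) ∧ (∀ t, |P t| ≤ 1) ∧
      ∀ t, v t ^ (4 / ((n : ℝ) - 2)) ≤ ((n : ℝ) - 2) / (-Real.log ε) + P' t := by
  have hn' : (3 : ℝ) ≤ n := by exact_mod_cast hn
  have hfi := hv.first_integral hn
  obtain ⟨m, hm⟩ : ∃ m : ℝ, m = ((n : ℝ) - 2) / 2 := ⟨_, rfl⟩
  have hnm : (n : ℝ) - 2 = 2 * m := by linarith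
  have hmpos : 0 < m := by linarith
  have hε0 : 0 < ε := by
    obtain ⟨t₀, ht₀⟩ := hv.isLeast.1
    exact ht₀ ▸ hv.pos t₀
  have hlog : Real.log ε < 0 := Real.log_neg hε0 hε
  obtain ⟨L, hL⟩ : ∃ L, L = -Real.log ε := ⟨_, rfl⟩
  have hLpos : 0 < L := by linarith
  have hexp : 0 < 4 / ((n : ℝ) - 2) := by rw [hnm]; positivity
  have hqε : ε ^ (4 / ((n : ℝ) - 2)) ≤ 1 := Real.rpow_le_one hε0.le hε.le hexp.le
  have hqε0 : 0 ≤ ε ^ (4 / ((n : ℝ) - 2)) := Real.rpow_nonneg hε0.le _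
  obtain ⟨h, hh⟩ : ∃ h, h = m ^ 2 * (ε ^ 2 * (1 - ε ^ (4 / ((n : ℝ) - 2)))) := ⟨_, rfl⟩
  have hh0 : 0 ≤ h := by
    rw [hh]
    have : 0 ≤ 1 - ε ^ (4 / ((n : ℝ) - 2)) := by linarith
    positivity
  have hhle : h ≤ m ^ 2 * ε ^ 2 := by
    rw [hh]
    refine mul_le_mul_of_nonneg_left ?_ (by positivity)
    nlinarith [sq_nonneg ε]
  have hfi' : ∀ t, deriv v t ^ 2 = m ^ 2 * (v t ^ 2 * (1 - v t ^ (4 / ((n : ℝ) - 2)))) - h :=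
    fun t => by rw [hfi t, hh, hm]
  have hv1 : ∀ t, v t ≤ 1 := fun t => by
    by_contra hcon
    push Not at hcon
    have h1 := Real.one_lt_rpow hcon hexp
    have h2 := hfi' t
    have h3 : 0 < m ^ 2 * (v t ^ 2 * (v t ^ (4 / ((n : ℝ) - 2)) - 1)) :=
      mul_pos (by positivity) (mul_pos (pow_pos (hv.pos t) 2) (by linarith))
    nlinarith [sq_nonneg (deriv v t)]
  have hvε : ∀ t, ε ≤ v t := fun t => hv.isLeast.2 (mem_range_self t)
  have hd1 : ∀ s, HasDerivAt v (deriv v s) s := fun s =>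
    (hv.contDiff.differentiable (by norm_num) s).hasDerivAt
  have hd2 : ∀ s, HasDerivAt (deriv v) (iteratedDeriv 2 v s) s := fun s => by
    have h : Differentiable ℝ (deriv v) := by
      have := hv.contDiff.differentiable_iteratedDeriv 1 (by norm_num)
      rwa [iteratedDeriv_one] at this
    have h2 := (h s).hasDerivAt
    rwa [show iteratedDeriv 2 v s = deriv (deriv v) s by
      rw [iteratedDeriv_succ, iteratedDeriv_one]]
  have hp2 : ∀ t, (deriv v t / v t) ^ 2 = m ^ 2 * (1 - v t ^ (4 / ((n : ℝ) - 2))) - h / v t ^ 2 :=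
    fun t => by
      have := (hv.pos t).ne'
      rw [div_pow, hfi' t]
      field_simp
  have hq0 : ∀ t, 0 ≤ v t ^ (4 / ((n : ℝ) - 2)) := fun t => Real.rpow_nonneg (hv.pos t).le _
  have hp2le : ∀ t, (deriv v t / v t) ^ 2 ≤ m ^ 2 := fun t => by
    rw [hp2 t]
    have : 0 ≤ h / v t ^ 2 := by positivity
    nlinarith [hq0 t, sq_nonneg m, mul_nonneg (sq_nonneg m) (hq0 t)]
  -- With `p = v'/v` and `q` the potential, this says `p' = -m q + h/v²`: up to the term `h/v²`, `q`
  -- is the derivative of the bounded function `-p/m`.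
  have hp : ∀ t, HasDerivAt (fun s => deriv v s / v s)
      (-m * v t ^ (4 / ((n : ℝ) - 2)) + h / v t ^ 2) t := fun t => by
    refine ((hd2 t).div (hd1 t) (hv.pos t).ne').congr_deriv ?_
    have he := hv.equation t
    have hpos := hv.pos t
    have e1 : v t ^ (((n : ℝ) + 2) / ((n : ℝ) - 2)) = v t * v t ^ (4 / ((n : ℝ) - 2)) := by
      have hn2 : (n : ℝ) - 2 ≠ 0 := by linarith
      rw [show ((n : ℝ) + 2) / ((n : ℝ) - 2) = 1 + 4 / ((n : ℝ) - 2) by field_simp; ring,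
        Real.rpow_add hpos, Real.rpow_one]
    rw [e1, show (n : ℝ) * ((n : ℝ) - 2) / 4 = m * (m + 1) by rw [hm]; ring,
      show ((n : ℝ) - 2) ^ 2 / 4 = m ^ 2 by rw [hm]; ring] at he
    have hf := hfi' t
    rw [show iteratedDeriv 2 v t = m ^ 2 * v t
      - m * (m + 1) * (v t * v t ^ (4 / ((n : ℝ) - 2))) by linarith]
    have hvne := hpos.ne'
    rw [← pow_two (deriv v t), hf]
    field_simp
    ring
  -- The cutoff `1 + log v / L` equals `0` at `v = ε`, where `h/v²` is not small, and `1` at `v =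
  -- 1`, where `q` is largest. Its derivative `p/L` costs only `O(1/L)`.
  refine ⟨fun t => -(deriv v t / v t * (1 + Real.log (v t) / L)) / m,
    fun t => -((-m * v t ^ (4 / ((n : ℝ) - 2)) + h / v t ^ 2) * (1 + Real.log (v t) / L)
      + deriv v t / v t * (deriv v t / v t / L)) / m, fun t => ?_, fun t => ?_, fun t => ?_⟩
  · exact (((hp t).mul ((((hd1 t).log (hv.pos t).ne').div_const L).const_add 1)).neg).div_const m
  · have ha : |1 + Real.log (v t) / L| ≤ 1 := by
      have h1 : Real.log (v t) ≤ 0 := Real.log_nonpos (hv.pos t).le (hv1 t)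
      have h2 : -L ≤ Real.log (v t) := by
        rw [hL, neg_neg]; exact Real.log_le_log hε0 (hvε t)
      have h3 : Real.log (v t) / L ≤ 0 := div_nonpos_of_nonpos_of_nonneg h1 hLpos.le
      have h4 : -1 ≤ Real.log (v t) / L := by rw [le_div_iff₀ hLpos]; linarith
      rw [abs_le]; constructor <;> linarith
    have hpm : |deriv v t / v t| ≤ m := abs_le_of_sq_le_sq (hp2le t) hmpos.le |> fun h => by
      simpa using h
    rw [abs_div, abs_neg, abs_mul, abs_of_pos hmpos, div_le_one hmpos]
    calc _ ≤ m * 1 := mul_le_mul hpm ha (abs_nonneg _) hmpos.le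
      _ = m := mul_one m
  · obtain ⟨y, hy⟩ : ∃ y, y = Real.log (v t) := ⟨_, rfl⟩
    have hvy : v t = Real.exp y := by rw [hy, Real.exp_log (hv.pos t)]
    have hεL : ε = Real.exp (-L) := by rw [hL, neg_neg, Real.exp_log hε0]
    have h1 : y ≤ 0 := hy ▸ Real.log_nonpos (hv.pos t).le (hv1 t)
    have h2 : -L ≤ y := by
      rw [hL, neg_neg, hy]; exact Real.log_le_log hε0 (hvε t)
    have hxe : ∀ x : ℝ, x * Real.exp (-x) ≤ 1 := fun x => by
      rw [Real.exp_neg, ← div_eq_mul_inv, div_le_one (Real.exp_pos x)]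
      linarith [Real.add_one_le_exp x]
    have b1 : v t ^ (4 / ((n : ℝ) - 2)) * (-y) ≤ m / 2 := by
      have := hxe (-(2 * y / m))
      have hq : v t ^ (4 / ((n : ℝ) - 2)) = Real.exp (2 * y / m) := by
        rw [hvy, ← Real.exp_mul, hnm]
        congr 1
        field_simp
        ring
      rw [neg_neg, ← hq] at this
      have h5 := mul_le_mul_of_nonneg_left this (show 0 ≤ m / 2 by positivity)
      calc _ = m / 2 * (-(2 * y / m) * v t ^ (4 / ((n : ℝ) - 2))) := by field_simp
        _ ≤ _ := by linarith
    have b2 : h / v t ^ 2 * (y + L) ≤ m ^ 2 / 2 := by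
      have h5 := hxe (2 * (y + L))
      have h6 : h / v t ^ 2 ≤ m ^ 2 * Real.exp (-(2 * (y + L))) := by
        rw [div_le_iff₀ (pow_pos (hv.pos t) 2)]
        refine hhle.trans (le_of_eq ?_)
        rw [hvy, hεL, ← Real.exp_nat_mul, ← Real.exp_nat_mul, mul_assoc, ← Real.exp_add]
        congr 2
        push_cast
        ring
      have h7 := mul_le_mul_of_nonneg_right h6 (show 0 ≤ y + L by linarith)
      nlinarith [mul_le_mul_of_nonneg_left h5 (sq_nonneg m)]
    have b3 := hp2le t
    beta_reduce
    rw [← hL, ← hy, hnm]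
    rw [hnm] at b1
    generalize deriv v t / v t = p at *
    generalize v t ^ (4 / (2 * m)) = Q at *
    generalize h / v t ^ 2 = k at *
    -- The slack is a sum of the three errors: `q` where the cutoff is below `1`, `h/v²` where it is
    -- positive, and the derivative of the cutoff.
    have hid : 2 * m / L + -((-m * Q + k) * (1 + y / L) + p * (p / L)) / m - Q
        = (m * (m / 2 - Q * (-y)) + (m ^ 2 / 2 - k * (y + L)) + (m ^ 2 - p ^ 2)) / (m * L) := by
      field_simp
      ring
    have : 0 ≤ (m * (m / 2 - Q * (-y)) + (m ^ 2 / 2 - k * (y + L)) + (m ^ 2 - p ^ 2)) / (m * L) :=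
      div_nonneg (by nlinarith [mul_nonneg hmpos.le (sub_nonneg.2 b1)]) (by positivity)
    linarith

/-! ### Backward energy estimate with an exponential barrier. -/

/-- The slope comparison behind the energy barrier. -/
theorem barrier_slope_lt {x y w γ m μ κ b Q F θ δ η r A B : ℝ} (hx : 0 ≤ x) (hy : 0 ≤ y)
    (hF0 : 0 ≤ F) (hm : 0 < m) (hxym : x ^ 2 + y ^ 2 = m ^ 2)
    (hw : 2 * μ * w ≤ x + y) (hγle : γ ≤ κ * Q * w + F) (hF : 2 * F < m * θ) (hb : 0 ≤ b)
    (hκ : κ = b * μ) (hθ : θ = δ - μ - b * η) (hμ : 0 < μ) (hQ : Q ≤ η + r) (hQ0 : 0 ≤ Q)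
    (hA : A ≥ -μ * x ^ 2 - x * γ) (hB : B ≥ -y * γ) :
    -(2 * A + 2 * B) < -(2 * m * (m * (-δ - b * r))) := by
  have hxy : (x + y) ^ 2 ≤ 2 * m ^ 2 := by linarith [sq_nonneg (x - y)]
  have hxy' : x + y ≤ 2 * m :=
    (abs_le_of_sq_le_sq' (by linarith [sq_nonneg m]) (by positivity)).2
  have hbQ : 0 ≤ b * Q := mul_nonneg hb hQ0
  have h1 : κ * Q * w ≤ b * Q * ((x + y) / 2) := by
    rw [hκ]
    linarith [mul_le_mul_of_nonneg_left hw hbQ]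
  have h3 := mul_le_mul_of_nonneg_left (hγle.trans (add_le_add_left h1 F)) (add_nonneg hx hy)
  have h4 := mul_le_mul_of_nonneg_left hxy hbQ
  have h5 := mul_le_mul_of_nonneg_right hxy' hF0
  have h6 := mul_lt_mul_of_pos_left hF hm
  have h7 := mul_le_mul_of_nonneg_left hQ (mul_nonneg hb (sq_nonneg m))
  have h8 : μ * x ^ 2 ≤ μ * m ^ 2 :=
    mul_le_mul_of_nonneg_left (by linarith [sq_nonneg y]) hμ.le
  rw [hθ] at h6
  linarith

/-- Backward energy estimate for `W'' = μ² W + g`, where `g` is bounded by `κ q ‖W‖` plus an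
exponentially weighted term and `q` is small up to the derivative of a bounded function. -/
theorem norm_le_of_backward_equation {E : Type*} [NormedAddCommGroup E] [InnerProductSpace ℝ E]
    {a T μ κ η δ N : ℝ} (hμ : 0 < μ) (hκ : 0 ≤ κ) (hN : 0 < N) (hη : κ * η / μ < δ - μ)
    {P P' q : ℝ → ℝ} (hP : ∀ t, HasDerivAt P (P' t) t) (hP1 : ∀ t, |P t| ≤ 1)
    (hq : ∀ t, q t ≤ η + P' t) (hq0 : ∀ t, 0 ≤ q t)
    {W V g : ℝ → E} (hW : ∀ t ∈ Ioo a T, HasDerivAt W (V t) t)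
    (hV : ∀ t ∈ Ioo a T, HasDerivAt V (μ ^ 2 • W t + g t) t)
    (hg : ∀ t ∈ Ioo a T, ‖g t‖ ≤ κ * q t * ‖W t‖ + N * Real.exp (-(δ * t)))
    (hWT : Filter.Tendsto W (nhdsWithin T (Iio T)) (nhds 0))
    (hVT : Filter.Tendsto V (nhdsWithin T (Iio T)) (nhds 0)) {t : ℝ} (ht : t ∈ Ioo a T) :
    ‖W t‖ ≤ 3 * Real.exp (2 * (κ / μ)) / (μ * (δ - μ - κ * η / μ)) * N * Real.exp (-(δ * t)) := by
  obtain ⟨θ, hθ⟩ : ∃ θ, θ = δ - μ - κ * η / μ := ⟨_, rfl⟩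
  have hθpos : 0 < θ := by linarith
  obtain ⟨b, hb⟩ : ∃ b, b = κ / μ := ⟨_, rfl⟩
  have hb0 : 0 ≤ b := by rw [hb]; positivity
  -- The factor `exp b` offsets the lower bound `exp(-b P) ≥ exp(-b)`; the `3` makes the forcing
  -- bound `2 F < M θ` strict.
  obtain ⟨D, hD⟩ : ∃ D, D = 3 * Real.exp b / θ := ⟨_, rfl⟩
  have hDpos : 0 < D := by rw [hD]; positivity
  let M : ℝ → ℝ := fun s => D * N * Real.exp (-(δ * s) - b * P s)
  have hMpos : ∀ s, 0 < M s := fun s => by positivity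
  have hM : ∀ s, HasDerivAt M (M s * (-δ - b * P' s)) s := fun s => by
    have h1 : HasDerivAt (fun s => -(δ * s) - b * P s) (-δ - b * P' s) s := by
      exact (((hasDerivAt_id' s).const_mul δ).neg.sub ((hP s).const_mul b)).congr_deriv (by ring)
    exact (h1.exp.const_mul (D * N)).congr_deriv (by simp only [M]; ring)
  -- `V - μ W` and `V + μ W` diagonalise the free equation, with rates `-μ` and `μ`. Backward in
  -- time only the first grows.
  let e : ℝ → ℝ := fun s => ‖V s - μ • W s‖ ^ 2 + ‖V s + μ • W s‖ ^ 2
  have he : ∀ s ∈ Ioo a T, HasDerivAt e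
      (2 * inner ℝ (V s - μ • W s) (μ ^ 2 • W s + g s - μ • V s)
        + 2 * inner ℝ (V s + μ • W s) (μ ^ 2 • W s + g s + μ • V s)) s := fun s hs =>
    (((hV s hs).sub ((hW s hs).const_smul μ)).norm_sq).add
      (((hV s hs).add ((hW s hs).const_smul μ)).norm_sq)
  have hS : ∀ s, 2 * μ * ‖W s‖ ≤ ‖V s - μ • W s‖ + ‖V s + μ • W s‖ := fun s => by
    have h1 := norm_sub_le (V s + μ • W s) (V s - μ • W s)
    rw [show V s + μ • W s - (V s - μ • W s) = (2 * μ) • W s by module, norm_smul,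
      Real.norm_of_nonneg (by positivity)] at h1
    linarith
  have hedge : ∀ s ∈ Ioo a T, e s = M s ^ 2 →
      -(2 * inner ℝ (V s - μ • W s) (μ ^ 2 • W s + g s - μ • V s)
        + 2 * inner ℝ (V s + μ • W s) (μ ^ 2 • W s + g s + μ • V s))
        < -(2 * M s * (M s * (-δ - b * P' s))) := fun s hs hes => by
    have hlow1 : inner ℝ (V s - μ • W s) (μ ^ 2 • W s + g s - μ • V s)
        ≥ -μ * ‖V s - μ • W s‖ ^ 2 - ‖V s - μ • W s‖ * ‖g s‖ := by
      rw [show μ ^ 2 • W s + g s - μ • V s = (-μ) • (V s - μ • W s) + g s by module,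
        inner_add_right, real_inner_smul_right, real_inner_self_eq_norm_sq]
      linarith [neg_le_of_abs_le (abs_real_inner_le_norm (V s - μ • W s) (g s))]
    have hlow2 : inner ℝ (V s + μ • W s) (μ ^ 2 • W s + g s + μ • V s)
        ≥ -‖V s + μ • W s‖ * ‖g s‖ := by
      rw [show μ ^ 2 • W s + g s + μ • V s = μ • (V s + μ • W s) + g s by module,
        inner_add_right, real_inner_smul_right, real_inner_self_eq_norm_sq]
      have : 0 ≤ μ * ‖V s + μ • W s‖ ^ 2 := by positivity
      linarith [neg_le_of_abs_le (abs_real_inner_le_norm (V s + μ • W s) (g s))]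
    have hSs := hS s
    have hgs := hg s hs
    have hx0 := norm_nonneg (V s - μ • W s)
    have hy0 := norm_nonneg (V s + μ • W s)
    simp only [e] at hes
    have hMs := hMpos s
    have hF : 2 * (N * Real.exp (-(δ * s))) < M s * θ := by
      have h1 : Real.exp (-b) ≤ Real.exp (-(b * P s)) := by
        apply Real.exp_le_exp.2
        nlinarith [le_of_abs_le (hP1 s)]
      have h2 : M s * θ = 3 * (N * Real.exp (-(δ * s))) * (Real.exp b * Real.exp (-(b * P s))) := by
        simp only [M]
        rw [sub_eq_add_neg, Real.exp_add, hD]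
        field_simp
      have h3 : 1 ≤ Real.exp b * Real.exp (-(b * P s)) := by
        calc (1 : ℝ) = Real.exp b * Real.exp (-b) := by rw [← Real.exp_add]; simp
          _ ≤ _ := mul_le_mul_of_nonneg_left h1 (Real.exp_pos b).le
      have h4 : 0 < N * Real.exp (-(δ * s)) := by positivity
      rw [h2]
      nlinarith
    exact barrier_slope_lt hx0 hy0 (by positivity) hMs hes hSs hgs hF hb0
      (show κ = b * μ by rw [hb]; field_simp) (show θ = δ - μ - b * η by rw [hθ, hb]; ring)
      hμ (hq s) (hq0 s) hlow1 hlow2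
  have heT : Filter.Tendsto e (nhdsWithin T (Iio T)) (nhds 0) := by
    have := (((hVT.sub (hWT.const_smul μ)).norm).pow 2).add
      (((hVT.add (hWT.const_smul μ)).norm).pow 2)
    simpa using this
  have hMT : Filter.Tendsto (fun s => M s ^ 2) (nhdsWithin T (Iio T)) (nhds (M T ^ 2)) :=
    (((hM T).continuousAt.tendsto).mono_left nhdsWithin_le_nhds).pow 2
  -- Only limits are known at `T`, so the comparison starts at an earlier time where the energy
  -- already lies below the barrier.
  obtain ⟨t₁, ⟨ht₁e, ht₁⟩⟩ := ((heT.eventually_lt hMT (pow_pos (hMpos T) 2)).and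
    (Ioo_mem_nhdsLT ht.2)).exists
  have hsub : ∀ s ∈ Icc (-t₁) (-t), -s ∈ Ioo a T := fun s hs =>
    ⟨by linarith [hs.2, ht.1], by linarith [hs.1, ht₁.2]⟩
  have hneg : ∀ {φ : ℝ → ℝ} {φ' s : ℝ}, HasDerivAt φ φ' (-s) →
      HasDerivAt (fun s => φ (-s)) (-φ') s := fun {φ φ' s} h => by
    exact (h.comp s (hasDerivAt_neg s)).congr_deriv (by ring)
  -- Time is reversed to use the forward comparison principle; at a contact point `hedge` gives the
  -- strict slope inequality.
  have hcmp : e t ≤ M t ^ 2 := by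
    have := image_le_of_deriv_right_lt_deriv_boundary' (f := fun s => e (-s))
      (B := fun s => M (-s) ^ 2) (a := -t₁) (b := -t)
      (f' := fun s => -(2 * inner ℝ (V (-s) - μ • W (-s)) (μ ^ 2 • W (-s) + g (-s) - μ • V (-s))
        + 2 * inner ℝ (V (-s) + μ • W (-s)) (μ ^ 2 • W (-s) + g (-s) + μ • V (-s))))
      (B' := fun s => -(2 * M (-s) * (M (-s) * (-δ - b * P' (-s)))))
      (fun s hs => (hneg (he _ (hsub s hs))).continuousAt.continuousWithinAt)
      (fun s hs => (hneg (he _ (hsub s (Ico_subset_Icc_self hs)))).hasDerivWithinAt)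
      (by simpa using ht₁e.le)
      (fun s _ => ((hM (-s)).continuousAt.comp continuousAt_neg).pow 2 |>.continuousWithinAt)
      (fun s hs => (hneg (φ := fun s => M s ^ 2)
        (((hM (-s)).pow 2).congr_deriv (by simp))).hasDerivWithinAt)
      (fun s hs hes => hedge _ (hsub s (Ico_subset_Icc_self hs)) hes)
      (right_mem_Icc.2 (by linarith [ht₁.1]))
    simpa using this
  have hfin : μ * ‖W t‖ ≤ M t := by
    have h1 := hS t
    simp only [e] at hcmp
    have h2 : ‖V t - μ • W t‖ + ‖V t + μ • W t‖ ≤ 2 * M t := by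
      refine (abs_le_of_sq_le_sq' ?_ (by linarith [hMpos t])).2
      nlinarith [sq_nonneg (‖V t - μ • W t‖ - ‖V t + μ • W t‖), sq_nonneg (M t)]
    linarith
  have hMle : M t ≤ D * N * (Real.exp (-(δ * t)) * Real.exp b) := by
    simp only [M]
    rw [← Real.exp_add]
    refine mul_le_mul_of_nonneg_left (Real.exp_le_exp.2 ?_) (by positivity)
    nlinarith [neg_le_of_abs_le (hP1 t)]
  rw [← hθ, ← hb]
  have h9 : ‖W t‖ ≤ D * N * (Real.exp (-(δ * t)) * Real.exp b) / μ := by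
    rw [le_div_iff₀ hμ]; linarith
  refine h9.trans (le_of_eq ?_)
  rw [hD, two_mul b, Real.exp_add]
  field_simp

/-! ### Terminal data and the estimate for a single mode. -/

/-- If `W` has one-sided derivative `V₀` at `T` and a bounded second derivative to the left of `T`,
then its derivative tends to `V₀` from the left. -/
theorem tendsto_deriv_of_bounded_second_deriv {E : Type*} [NormedAddCommGroup E] [NormedSpace ℝ E]
    [CompleteSpace E] {a T K : ℝ} (haT : a < T) {W V U : ℝ → E} {V₀ : E}
    (hW : ∀ t ∈ Ioo a T, HasDerivAt W (V t) t) (hV : ∀ t ∈ Ioo a T, HasDerivAt V (U t) t)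
    (hU : ∀ t ∈ Ioo a T, ‖U t‖ ≤ K) (hT : HasDerivWithinAt W V₀ (Iic T) T) :
    Filter.Tendsto V (nhdsWithin T (Iio T)) (nhds V₀) := by
  have hK : 0 ≤ K := by
    obtain ⟨s, hs⟩ := nonempty_Ioo.2 haT
    exact (norm_nonneg _).trans (hU s hs)
  have hlip : LipschitzOnWith K.toNNReal V (Ioo a T) :=
    (convex_Ioo a T).lipschitzOnWith_of_nnnorm_hasDerivWithin_le
      (fun x hx => (hV x hx).hasDerivWithinAt) (fun x hx => by
        rw [← NNReal.coe_le_coe, coe_nnnorm, Real.coe_toNNReal K hK]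
        exact hU x hx)
  -- The Lipschitz bound makes `V` Cauchy at `T`; its limit is then a one-sided derivative of `W`,
  -- hence equals `V₀`.
  have hmem : Ioo a T ∈ nhdsWithin T (Iio T) := Ioo_mem_nhdsLT haT
  have hcauchy : Cauchy (Filter.map V (nhdsWithin T (Iio T))) :=
    (cauchy_nhds.mono nhdsWithin_le_nhds).map_of_le hlip.uniformContinuousOn
      (Filter.le_principal_iff.2 hmem)
  obtain ⟨V₁, hV₁⟩ := CompleteSpace.complete hcauchy
  have hderiv : HasDerivWithinAt W V₁ (Iic T) T := by
    refine hasDerivWithinAt_Iic_of_tendsto_deriv (s := Ioo a T)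
      (fun x hx => (hW x hx).differentiableAt.differentiableWithinAt)
      (hT.continuousWithinAt.mono fun x hx => hx.2.le) hmem ?_
    refine Filter.Tendsto.congr' ?_ hV₁
    filter_upwards [hmem] with x hx using (hW x hx).deriv.symm
  have huniq : V₁ = V₀ := (uniqueDiffWithinAt_Iic T).eq_deriv _ hderiv hT
  exact huniq ▸ hV₁

/-- The backward estimate for a single mode with exponential rate `μ`. -/
theorem IsFowlerProfile.backward_estimate {n : ℕ} (hn : 3 ≤ n) {δ μ : ℝ} (hμ : 0 < μ)
    (hμδ : μ < δ) :
    ∃ ε₀ ∈ Ioo (0 : ℝ) ((((n : ℝ) - 2) / n) ^ (((n : ℝ) - 2) / 4)), ∃ C > (0 : ℝ),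
      ∀ j : Fin (n + 1), ((n : ℝ) - 2) ^ 2 / 4 + lowEigenvalue n j = μ ^ 2 →
      ∀ (d : ℕ) (Λ : EuclideanSpace ℝ (Fin d)), ‖Λ‖ = 1 →
      ∀ ε ∈ Ioc 0 ε₀, ∀ v : ℝ → ℝ, IsFowlerProfile n ε v →
      ∀ a T : ℝ, a < T → ∀ f W : ℝ → EuclideanSpace ℝ (Fin d),
        MemWeighted 0 δ (Iio T) f → IsBackwardSolution n j Λ v T f W →
        weightedSup δ (Ioo a T) W ≤ ENNReal.ofReal C * weightedSup δ (Ioo a T) f := by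
  have hn' : (3 : ℝ) ≤ n := by exact_mod_cast hn
  -- `n + n(n-2)/4`, the total weight of the two coupling terms.
  obtain ⟨κ, hκ⟩ : ∃ κ : ℝ, κ = (n : ℝ) * (n + 2) / 4 := ⟨_, rfl⟩
  have hκpos : 0 < κ := by rw [hκ]; positivity
  obtain ⟨ω, hω⟩ : ∃ ω, ω = ((n : ℝ) - 2) / n := ⟨_, rfl⟩
  have hωpos : 0 < ω := by rw [hω]; apply div_pos <;> linarith
  have hω1 : ω < 1 := by rw [hω, div_lt_one] <;> linarith
  have hthr : 0 < ω ^ (((n : ℝ) - 2) / 4) := Real.rpow_pos_of_pos hωpos _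
  have hthr1 : ω ^ (((n : ℝ) - 2) / 4) < 1 := Real.rpow_lt_one hωpos.le hω1 (by linarith)
  -- Chosen so that the averaged coupling uses exactly half of the gap `δ - μ`.
  obtain ⟨η, hη⟩ : ∃ η, η = μ * (δ - μ) / (2 * κ) := ⟨_, rfl⟩
  have hηpos : 0 < η := by
    rw [hη]; exact div_pos (mul_pos hμ (by linarith)) (by positivity)
  have hκη : κ * η / μ = (δ - μ) / 2 := by rw [hη]; field_simp
  rw [← hω]
  -- The exponential makes `(n-2)/(-log ε) ≤ η`; half the threshold keeps `ε₀` strictly admissible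
  -- and `ε < 1`.
  refine ⟨min (Real.exp (-((n - 2) / η))) (ω ^ (((n : ℝ) - 2) / 4) / 2),
    ⟨lt_min (Real.exp_pos _) (by linarith), (min_le_right _ _).trans_lt (by linarith)⟩,
    3 * Real.exp (2 * (κ / μ)) / (μ * (δ - μ - κ * η / μ)),
    div_pos (by positivity) (mul_pos hμ (by rw [hκη]; linarith)), ?_⟩
  obtain ⟨C, hC⟩ : ∃ C, C = 3 * Real.exp (2 * (κ / μ)) / (μ * (δ - μ - κ * η / μ)) := ⟨_, rfl⟩
  have hCpos : 0 < C := by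
    rw [hC]; exact div_pos (by positivity) (mul_pos hμ (by rw [hκη]; linarith))
  intro j hj d Λ hΛ ε hε v hv a T haT f W hf hW
  have hε1 : ε < 1 := by
    have := hε.2.trans (min_le_right _ _)
    linarith
  have hlog : ((n : ℝ) - 2) / (-Real.log ε) ≤ η := by
    have h1 : Real.log ε ≤ -((n - 2) / η) := by
      rw [← Real.log_exp (-((n - 2) / η))]
      exact Real.log_le_log hε.1 (hε.2.trans (min_le_left _ _))
    have h2 : 0 < -Real.log ε := by linarith [Real.log_neg hε.1 hε1]
    rw [div_le_iff₀ h2]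
    have h3 : ((n : ℝ) - 2) / η ≤ -Real.log ε := by linarith
    rw [div_le_iff₀ hηpos] at h3
    linarith
  obtain ⟨P, P', hP, hP1, hq⟩ := hv.exists_corrector hn hε1
  have hfN : weightedSup δ (Ioo a T) f ≠ ⊤ := by
    refine (lt_of_le_of_lt ?_ (hf.2 0 le_rfl)).ne
    simp only [weightedSup, iteratedDerivWithin_zero]
    exact biSup_mono fun t ht => ht.2
  obtain ⟨N, hN⟩ : ∃ N, N = (weightedSup δ (Ioo a T) f).toReal := ⟨_, rfl⟩
  have hN0 : 0 ≤ N := hN ▸ ENNReal.toReal_nonneg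
  have hNf : weightedSup δ (Ioo a T) f = ENNReal.ofReal N := by
    rw [hN, ENNReal.ofReal_toReal hfN]
  have hfb : ∀ t ∈ Ioo a T, ‖f t‖ ≤ N * Real.exp (-(δ * t)) := fun t ht => by
    have h1 : ENNReal.ofReal (Real.exp (δ * t) * ‖f t‖) ≤ ENNReal.ofReal N := by
      rw [← hNf]
      exact le_biSup (fun t => ENNReal.ofReal (Real.exp (δ * t) * ‖f t‖)) ht
    rw [ENNReal.ofReal_le_ofReal_iff hN0] at h1
    rw [Real.exp_neg, ← div_eq_mul_inv, le_div_iff₀ (Real.exp_pos _)]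
    linarith
  have hWd : ∀ t < T, HasDerivAt W (deriv W t) t := fun t ht =>
    ((hW.contDiffOn.contDiffAt (Iio_mem_nhds ht)).differentiableAt (by norm_num)).hasDerivAt
  have hVd : ∀ t < T, HasDerivAt (deriv W) (iteratedDeriv 2 W t) t := fun t ht => by
    have h1 : ContDiffAt ℝ 1 (deriv W) t :=
      (hW.contDiffOn.deriv_of_isOpen isOpen_Iio (by norm_num)).contDiffAt (Iio_mem_nhds ht)
    rw [show iteratedDeriv 2 W t = deriv (deriv W) t by
      rw [iteratedDeriv_succ, iteratedDeriv_one]]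
    exact (h1.differentiableAt (by norm_num)).hasDerivAt
  let g : ℝ → EuclideanSpace ℝ (Fin d) := fun t => f t
    - ((n : ℝ) * v t ^ (4 / ((n : ℝ) - 2)) * inner ℝ (W t) Λ) • Λ
    - ((n : ℝ) * ((n : ℝ) - 2) / 4 * v t ^ (4 / ((n : ℝ) - 2))) • W t
  have hcoord : ∀ t < T, ∀ i, iteratedDeriv 2 (fun s => W s i) t = iteratedDeriv 2 W t i :=
    fun t ht i => by
    have hproj : ∀ {φ : ℝ → EuclideanSpace ℝ (Fin d)} {φ' s}, HasDerivAt φ φ' s →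
        HasDerivAt (fun s => φ s i) (φ' i) s := fun {φ φ' s} h =>
      (EuclideanSpace.proj (𝕜 := ℝ) i).hasFDerivAt.comp_hasDerivAt s h
    have h1 : deriv (fun s => W s i) =ᶠ[nhds t] fun s => deriv W s i := by
      filter_upwards [Iio_mem_nhds ht] with s hs using (hproj (hWd s hs)).deriv
    rw [iteratedDeriv_succ, iteratedDeriv_one, h1.deriv_eq, (hproj (hVd t ht)).deriv]
  have hVd' : ∀ t < T, HasDerivAt (deriv W) (μ ^ 2 • W t + g t) t := fun t ht => by
    refine (hVd t ht).congr_deriv ?_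
    ext i
    have h1 := hW.equation t ht i
    rw [modeOperator, hcoord t ht i] at h1
    simp only [g, PiLp.add_apply, PiLp.sub_apply, PiLp.smul_apply, smul_eq_mul, ← h1, ← hj]
    ring
  have hq0 : ∀ t, 0 ≤ v t ^ (4 / ((n : ℝ) - 2)) := fun t => Real.rpow_nonneg (hv.pos t).le _
  have hg : ∀ t ∈ Ioo a T, ‖g t‖ ≤
      κ * v t ^ (4 / ((n : ℝ) - 2)) * ‖W t‖ + N * Real.exp (-(δ * t)) := fun t ht => by
    have h1 := norm_sub_le (f t - ((n : ℝ) * v t ^ (4 / ((n : ℝ) - 2)) * inner ℝ (W t) Λ) • Λ)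
      (((n : ℝ) * ((n : ℝ) - 2) / 4 * v t ^ (4 / ((n : ℝ) - 2))) • W t)
    have h2 := norm_sub_le (f t) (((n : ℝ) * v t ^ (4 / ((n : ℝ) - 2)) * inner ℝ (W t) Λ) • Λ)
    have h3 : |inner ℝ (W t) Λ| ≤ ‖W t‖ := by
      simpa [hΛ] using abs_real_inner_le_norm (W t) Λ
    have hn0 : 0 ≤ (n : ℝ) * ((n : ℝ) - 2) / 4 := by
      have : 0 ≤ (n : ℝ) - 2 := by linarith
      positivity
    have h4 := mul_le_mul_of_nonneg_left h3 (mul_nonneg (Nat.cast_nonneg' n) (hq0 t))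
    rw [norm_smul, hΛ, mul_one, Real.norm_eq_abs, abs_mul,
      abs_of_nonneg (mul_nonneg (Nat.cast_nonneg' n) (hq0 t))] at h2
    rw [norm_smul ((n : ℝ) * ((n : ℝ) - 2) / 4 * v t ^ (4 / ((n : ℝ) - 2))), Real.norm_eq_abs,
      abs_of_nonneg (mul_nonneg hn0 (hq0 t))] at h1
    have h5 : κ * v t ^ (4 / ((n : ℝ) - 2)) * ‖W t‖ = n * v t ^ (4 / ((n : ℝ) - 2)) * ‖W t‖
        + (n : ℝ) * ((n : ℝ) - 2) / 4 * v t ^ (4 / ((n : ℝ) - 2)) * ‖W t‖ := by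
      rw [hκ]; ring
    linarith [hfb t ht]
  have hWT : Filter.Tendsto W (nhdsWithin T (Iio T)) (nhds 0) := by
    have h1 := hW.terminal_deriv.continuousWithinAt.tendsto
    rw [hW.terminal_value] at h1
    exact h1.mono_left (nhdsWithin_mono _ Iio_subset_Iic_self)
  have hVT : Filter.Tendsto (deriv W) (nhdsWithin T (Iio T)) (nhds 0) := by
    obtain ⟨K, hcont⟩ : ∃ K, Filter.Tendsto (fun t => μ ^ 2 * ‖W t‖
        + (κ * v t ^ (4 / ((n : ℝ) - 2)) * ‖W t‖ + N * Real.exp (-(δ * t))))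
        (nhdsWithin T (Iio T)) (nhds K) := by
      have hvc : Filter.Tendsto (fun t => v t ^ (4 / ((n : ℝ) - 2))) (nhdsWithin T (Iio T))
          (nhds (v T ^ (4 / ((n : ℝ) - 2)))) :=
        ((hv.contDiff.continuous.continuousAt.rpow_const
          (Or.inl (hv.pos T).ne')).tendsto).mono_left nhdsWithin_le_nhds
      have hec : Filter.Tendsto (fun t => Real.exp (-(δ * t))) (nhdsWithin T (Iio T))
          (nhds (Real.exp (-(δ * T)))) :=
        ((show Continuous fun t => Real.exp (-(δ * t)) by fun_prop).tendsto T).mono_left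
          nhdsWithin_le_nhds
      exact ⟨_, (hWT.norm.const_mul _).add
        (((hvc.const_mul κ).mul hWT.norm).add (hec.const_mul N))⟩
    obtain ⟨b, hb, hbT⟩ := (mem_nhdsLT_iff_exists_Ioo_subset' haT).1
      (hcont.eventually_lt_const (lt_add_one _))
    refine tendsto_deriv_of_bounded_second_deriv (a := max a b) (K := K + 1) (max_lt haT hb)
      (fun t ht => hWd t ht.2) (fun t ht => hVd' t ht.2) (fun t ht => ?_) hW.terminal_deriv
    have ht' : t ∈ Ioo a T := ⟨(le_max_left a b).trans_lt ht.1, ht.2⟩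
    have h1 := hbT ⟨(le_max_right a b).trans_lt ht.1, ht.2⟩
    refine (norm_add_le _ _).trans (le_trans ?_ (le_of_lt h1))
    rw [norm_smul, Real.norm_of_nonneg (sq_nonneg μ)]
    linarith [hg t ht']
  rw [← hC, hNf, ← ENNReal.ofReal_mul hCpos.le]
  refine iSup₂_le fun t ht => ENNReal.ofReal_le_ofReal ?_
  -- The energy estimate needs a positive forcing bound, while `N` may be `0`; hence every `N' > N`
  -- is used.
  have hmain : ∀ N' > N, Real.exp (δ * t) * ‖W t‖ / C ≤ N' := fun N' hN' => by
    have h1 := norm_le_of_backward_equation (N := N') hμ hκpos.le (hN0.trans_lt hN')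
      (show κ * η / μ < δ - μ by rw [hκη]; linarith) hP hP1
      (fun t => (hq t).trans (by linarith)) hq0 (fun t ht => hWd t ht.2)
      (fun t ht => hVd' t ht.2) (fun t ht => (hg t ht).trans (by gcongr)) hWT hVT ht
    rw [← hC, Real.exp_neg, ← div_eq_mul_inv, le_div_iff₀ (Real.exp_pos _)] at h1
    rw [div_le_iff₀ hCpos]
    linarith
  have h2 := le_of_forall_gt_imp_ge_of_dense hmain
  rw [div_le_iff₀ hCpos] at h2
  linarith

theorem mainTheorem5 (n : ℕ) (hn : 3 ≤ n) (δ : ℝ) :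
    (((n : ℝ) - 2) / 2 < δ →
      ∃ ε₀ ∈ Set.Ioo (0 : ℝ) ((((n : ℝ) - 2) / n) ^ (((n : ℝ) - 2) / 4)), ∃ C > (0 : ℝ),
        ∀ (d : ℕ) (Λ : EuclideanSpace ℝ (Fin d)), ‖Λ‖ = 1 →
        ∀ ε ∈ Set.Ioc 0 ε₀, ∀ v : ℝ → ℝ, IsFowlerProfile n ε v →
        ∀ R > (0 : ℝ), ∀ T > Real.log R, ∀ f W : ℝ → EuclideanSpace ℝ (Fin d),
          MemWeighted 0 δ (Set.Iio T) f →
          MemWeighted 2 δ (Set.Ioo (Real.log R) T) W →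
          IsBackwardSolution n 0 Λ v T f W →
          weightedSup δ (Set.Ioo (Real.log R) T) W
            ≤ ENNReal.ofReal C * weightedSup δ (Set.Ioo (Real.log R) T) f) ∧
    ((n : ℝ) / 2 < δ →
      ∃ ε₀ ∈ Set.Ioo (0 : ℝ) ((((n : ℝ) - 2) / n) ^ (((n : ℝ) - 2) / 4)), ∃ C > (0 : ℝ),
        ∀ j : Fin (n + 1), j ≠ 0 →
        ∀ (d : ℕ) (Λ : EuclideanSpace ℝ (Fin d)), ‖Λ‖ = 1 →
        ∀ ε ∈ Set.Ioc 0 ε₀, ∀ v : ℝ → ℝ, IsFowlerProfile n ε v →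
        ∀ R > (0 : ℝ), ∀ T > Real.log R, ∀ f W : ℝ → EuclideanSpace ℝ (Fin d),
          MemWeighted 0 δ (Set.Iio T) f →
          MemWeighted 2 δ (Set.Ioo (Real.log R) T) W →
          IsBackwardSolution n j Λ v T f W →
          weightedSup δ (Set.Ioo (Real.log R) T) W
            ≤ ENNReal.ofReal C * weightedSup δ (Set.Ioo (Real.log R) T) f) := by
  have hn' : (3 : ℝ) ≤ n := by exact_mod_cast hn
  refine ⟨fun hδ => ?_, fun hδ => ?_⟩
  · obtain ⟨ε₀, hε₀, C, hC, h⟩ := IsFowlerProfile.backward_estimate hn (by linarith) hδ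
    refine ⟨ε₀, hε₀, C, hC, fun d Λ hΛ ε hε v hv R _ T hT f W hf _ hW => ?_⟩
    refine h 0 ?_ d Λ hΛ ε hε v hv _ T hT f W hf hW
    -- Here `μ = (n-2)/2`.
    rw [lowEigenvalue, if_pos rfl]
    ring
  · obtain ⟨ε₀, hε₀, C, hC, h⟩ := IsFowlerProfile.backward_estimate hn (by linarith) hδ
    refine ⟨ε₀, hε₀, C, hC, fun j hj d Λ hΛ ε hε v hv R _ T hT f W hf _ hW => ?_⟩
    refine h j ?_ d Λ hΛ ε hε v hv _ T hT f W hf hW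
    -- Here `μ = n/2`, since `(n-2)²/4 + (n-1) = n²/4`.
    rw [lowEigenvalue, if_neg hj]
    ring
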